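/- A finite sequence of jobs is to be scheduled on a single processor. Job $j$ has a release time $r(j)\ge 0$ and a size $p(j)>0$; preemption is free, and at any time the processor runs at some speed $s\in[0,\infty)$, which may be shared among several active jobs (jobs released but not yet completed), consuming $P(s)=s^\alpha$ units of energy per unit time. The cost of a schedule is its total flow time $\sum_j (C(j)-r(j))$, where $C(j)$ is the completion time of $j$, plus its energy $\int_0^\infty s(t)^\alpha\,dt$. A deterministic algorithm is nonclairvoyant if its decisions at time $t$ (the speed, and how it is divided among the active jobs) depend only on the jobs released by time $t$, with their release times, and on the jobs completed by time $t$, with their completion times and sizes; the size of a job is unknown until the job is completed. The algorithm is $C$-competitive if on every job sequence its cost is at most $C$ times the infimum of the costs of all schedules of that sequence. For every $0<\varepsilon<1/3$ there is a constant $c=c(\varepsilon)>0$ such that for every $\alpha>1$ and every deterministic nonclairvoyant algorithm (which may depend on $\alpha$): if the algorithm is $C$-competitive for the power function $P(s)=s^\alpha$, then $C\ge c\,\alpha^{1/3-\varepsilon}$. That is, every deterministic nonclairvoyant algorithm has competitive ratio $\Omega(\alpha^{1/3-\varepsilon})$. -/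

import Mathlib

open MeasureTheory
open scoped NNReal ENNReal

noncomputable section

namespace SpeedScaling

/-- A finite job sequence: job `i` has release time `release i` and work requirement `size i`.
Jobs are listed in order of release (ties in any order), and the position in the list is the
identifier of the job, so that an identifier carries no information about later jobs. -/
structure Instance where
  n : ℕ
  release : Fin n → ℝ
  size : Fin n → ℝ
  release_nonneg : ∀ i, 0 ≤ release i
  release_mono : Monotone release
  size_pos : ∀ i, 0 < size i

/-- Work received during `[0, t]` by a job that is processed at rate `ρ`. -/
def workDone (ρ : ℝ → ℝ≥0) (t : ℝ) : ℝ≥0∞ :=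
  ∫⁻ τ in Set.Icc 0 t, (ρ τ : ℝ≥0∞)

/-- A preemptive schedule of `I` on one processor: `rate i t` is the part of the processor speed
that is given to job `i` at time `t`. Only active jobs (released by time `t` and not yet completed
by time `t`) are processed. A schedule need not complete every job; if it does not, its flow time
is infinite. -/
structure Schedule (I : Instance) where
  rate : Fin I.n → ℝ → ℝ≥0
  measurable_rate : ∀ i, Measurable (rate i)
  active_of_rate_ne_zero : ∀ i t, rate i t ≠ 0 →
    I.release i ≤ t ∧ workDone (rate i) t < ENNReal.ofReal (I.size i)

namespace Schedule

variable {I : Instance}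

/-- The speed of the processor at time `t`. -/
def speed (σ : Schedule I) (t : ℝ) : ℝ≥0 := ∑ i, σ.rate i t

/-- The first time at which job `i` has received its whole work requirement
(`∞` if this never happens). -/
def completionTime (σ : Schedule I) (i : Fin I.n) : ℝ≥0∞ :=
  ⨅ (t : ℝ) (_ : ENNReal.ofReal (I.size i) ≤ workDone (σ.rate i) t), ENNReal.ofReal t

/-- Time elapsed from the release of job `i` until its completion. -/
def flowTime (σ : Schedule I) (i : Fin I.n) : ℝ≥0∞ :=
  σ.completionTime i - ENNReal.ofReal (I.release i)

def totalFlowTime (σ : Schedule I) : ℝ≥0∞ := ∑ i, σ.flowTime i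

/-- Energy usage for the power function `P(s) = s ^ α`. -/
def energy (σ : Schedule I) (α : ℝ) : ℝ≥0∞ :=
  ∫⁻ t in Set.Ici (0 : ℝ), (σ.speed t : ℝ≥0∞) ^ α

/-- Total flow time plus energy. -/
def cost (σ : Schedule I) (α : ℝ) : ℝ≥0∞ := σ.totalFlowTime + σ.energy α

/-- The completions that have occurred by time `t`: the job, the time of its completion, and its
size, which is revealed at that moment. -/
def completions (σ : Schedule I) (t : ℝ) : Set (ℕ × ℝ≥0∞ × ℝ) :=
  {e | ∃ i : Fin I.n, σ.completionTime i ≤ ENNReal.ofReal t ∧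
    e = ((i : ℕ), σ.completionTime i, I.size i)}

end Schedule

/-- The arrivals that have occurred by time `t`: the job and its release time, but not its size. -/
def Instance.arrivals (I : Instance) (t : ℝ) : Set (ℕ × ℝ) :=
  {e | ∃ i : Fin I.n, I.release i ≤ t ∧ e = ((i : ℕ), I.release i)}

/-- The optimal offline cost of `I`. -/
def optCost (α : ℝ) (I : Instance) : ℝ≥0∞ := ⨅ σ : Schedule I, σ.cost α

/-- A deterministic online nonclairvoyant algorithm: it assigns a schedule to every job sequence,
and what it does at time `t` is determined by the arrivals and the completions that have
occurred by time `t`. -/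
structure NonclairvoyantAlgorithm where
  run : (I : Instance) → Schedule I
  nonclairvoyant : ∀ (I I' : Instance) (t : ℝ), 0 ≤ t →
    I.arrivals t = I'.arrivals t →
    (run I).completions t = (run I').completions t →
    ∀ (i : Fin I.n) (i' : Fin I'.n), (i : ℕ) = (i' : ℕ) → (run I).rate i t = (run I').rate i' t

/-- `A` is `C`-competitive for total flow time plus energy with power function `s ^ α`. -/
def NonclairvoyantAlgorithm.IsCompetitive (A : NonclairvoyantAlgorithm) (α C : ℝ) : Prop :=
  ∀ I : Instance, (A.run I).cost α ≤ ENNReal.ofReal C * optCost α I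

end SpeedScaling

end

noncomputable section

/-! ### Work received as a function of time -/

namespace SpeedScaling

/-! For large `α`, exceeding unit speed noticeably is expensive: convexity of `s ^ α`
(`le_add_rpow_div`) turns any energy bound into a bound on the work done, `lam` per unit of time
plus a small multiple of the energy. The adversary exploits this twice, with `k` of order `α ^
(1/3)`, under the assumption `C < k / 30` (`IsCompetitive.le_mul`).

Release `k` long jobs at time `0` and let the algorithm run until `T = 2 * k ^ 2`. Its energy is at
most `C` times the optimum, so it does at most `2 * k ^ 2 + k` work, and no job is finished. Let `w
i` be the work received by job `i`. A nonclairvoyant algorithm behaves identically until `T` if the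
sizes are really `w i + 1` and unit jobs arrive later (`workDone_eq_of_extends`). In this second
instance the algorithm has one unit left of every burst job at time `T`, and then `k ^ 3` unit jobs
arrive, one per time unit.

Offline, the burst job with the largest `w` is postponed to the very end. The others fit into `[0,
T]` at unit speed, and each stream job is served on arrival, so the optimum is `O(k ^ 3)`
(`optCost_burstThenStream_le`). The algorithm cannot catch up: every job has at most one unit left
during the stream, so the number of active jobs is at least the remaining work, which stays above `k
/ 2` because the processor can hardly outrun the arrivals (`le_card_active_burstThenStream`). Its
flow time is at least `k ^ 4 / 2`, a contradiction. -/

theorem workDone_mono (ρ : ℝ → ℝ≥0) : Monotone (workDone ρ) := fun _ _ h =>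
  lintegral_mono_set (Set.Icc_subset_Icc_right h)

theorem workDone_eq_zero_of_forall_lt {ρ : ℝ → ℝ≥0} {t : ℝ} (h : ∀ s < t, ρ s = 0) :
    workDone ρ t = 0 := by
  rw [workDone, ← setLIntegral_congr Ico_ae_eq_Icc,
    setLIntegral_congr_fun (g := fun _ => 0) measurableSet_Ico
      (fun s hs => by simp [h s hs.2]), lintegral_zero]

theorem workDone_congr {ρ ρ' : ℝ → ℝ≥0} {t : ℝ} (h : ∀ s, 0 ≤ s → s < t → ρ s = ρ' s) :
    workDone ρ t = workDone ρ' t := by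
  rw [workDone, workDone, ← setLIntegral_congr Ico_ae_eq_Icc, ← setLIntegral_congr Ico_ae_eq_Icc]
  exact setLIntegral_congr_fun measurableSet_Ico (fun s hs => by simp [h s hs.1 hs.2])

theorem workDone_eq_measure {ρ : ℝ → ℝ≥0} (t : ℝ) :
    workDone ρ t = volume.withDensity (fun τ => (ρ τ : ℝ≥0∞)) (Set.Icc 0 t) := by
  rw [workDone, withDensity_apply _ measurableSet_Icc]

/-- Work received during `[0, t]` is right-continuous wherever it is locally finite. -/
theorem exists_gt_workDone_lt {ρ : ℝ → ℝ≥0} {t u : ℝ} (htu : t < u)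
    (hu : workDone ρ u ≠ ∞) {c : ℝ≥0∞} (hc : workDone ρ t < c) :
    ∃ s > t, workDone ρ s < c := by
  have hlim : Filter.Tendsto
      ((volume.withDensity (fun τ => (ρ τ : ℝ≥0∞))) ∘ fun s => Set.Icc 0 s)
      (nhdsWithin t (Set.Ioi t))
      (nhds (volume.withDensity (fun τ => (ρ τ : ℝ≥0∞)) (⋂ r > t, Set.Icc 0 r))) := by
    refine tendsto_measure_biInter_gt (fun _ _ => measurableSet_Icc.nullMeasurableSet)
      (fun i j _ h => Set.Icc_subset_Icc_right h) ⟨u, htu, ?_⟩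
    rwa [← workDone_eq_measure]
  have hset : (⋂ r > t, Set.Icc 0 r) = Set.Icc 0 t := by
    ext x
    simp only [Set.mem_iInter, Set.mem_Icc]
    constructor
    · intro h
      exact ⟨(h u htu).1, le_of_forall_gt_imp_ge_of_dense fun r hr => (h r hr).2⟩
    · exact fun h r hr => ⟨h.1, h.2.trans hr.le⟩
  rw [hset, ← workDone_eq_measure] at hlim
  obtain ⟨s, hs, hst⟩ := ((hlim.eventually_lt_const hc).and self_mem_nhdsWithin).exists
  exact ⟨s, hst, by rw [workDone_eq_measure]; exact hs⟩

/-! ### Completion, flow time and energy of a schedule -/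

namespace Schedule

variable {I : Instance} (σ : Schedule I)

theorem rate_eq_zero_of_lt_release {i : Fin I.n} {t : ℝ} (h : t < I.release i) :
    σ.rate i t = 0 := by
  by_contra hne
  exact absurd (σ.active_of_rate_ne_zero i t hne).1 (not_le.2 h)

/-- A job is processed only at times in the down-closed set `S` where its work is still below its
size. An increasing sequence of points of `S` exhausts `S`, and continuity of the measure from below
passes the bound to the limit. -/
theorem workDone_le_size (i : Fin I.n) (t : ℝ) :
    workDone (σ.rate i) t ≤ ENNReal.ofReal (I.size i) := by
  set S : Set ℝ := {s | workDone (σ.rate i) s < ENNReal.ofReal (I.size i)} with hS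
  have hlow : ∀ a ∈ S, ∀ b ≤ a, b ∈ S := fun a ha b hb =>
    lt_of_le_of_lt (workDone_mono _ hb) ha
  have hmeas : MeasurableSet S := (workDone_mono (σ.rate i)).measurable measurableSet_Iio
  have hsupp : workDone (σ.rate i) t
      ≤ volume.withDensity (fun τ => (σ.rate i τ : ℝ≥0∞)) (S ∩ Set.Ici 0) := by
    rw [withDensity_apply _ (hmeas.inter measurableSet_Ici), workDone,
      ← lintegral_indicator measurableSet_Icc,
      ← lintegral_indicator (hmeas.inter measurableSet_Ici)]
    refine lintegral_mono fun s => ?_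
    by_cases hs : σ.rate i s = 0
    · simp [Set.indicator, hs]
    · have hsS : s ∈ S := (σ.active_of_rate_ne_zero i s hs).2
      by_cases h0 : s ∈ Set.Icc 0 t
      · rw [Set.indicator_of_mem h0, Set.indicator_of_mem (show s ∈ S ∩ Set.Ici 0 from ⟨hsS, h0.1⟩)]
      · rw [Set.indicator_of_notMem h0]; exact zero_le
  refine hsupp.trans ?_
  rcases S.eq_empty_or_nonempty with hemp | hne
  · simp [hemp]
  obtain ⟨u, hmono, hu, huS⟩ : ∃ u : ℕ → ℝ, Monotone u ∧ (∀ n, u n ∈ S) ∧ ∀ x ∈ S, ∃ n, x ≤ u n := by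
    by_cases hbdd : BddAbove S
    · by_cases hmem : sSup S ∈ S
      · exact ⟨fun _ => sSup S, monotone_const, fun _ => hmem, fun x hx => ⟨0, le_csSup hbdd hx⟩⟩
      · obtain ⟨u, hu1, hu2, hu3⟩ := exists_seq_tendsto_sSup hne hbdd
        refine ⟨u, hu1, hu3, fun x hx => ?_⟩
        have hlt : x < sSup S := lt_of_le_of_ne (le_csSup hbdd hx) (fun h => hmem (h ▸ hx))
        obtain ⟨n, hn⟩ := (hu2.eventually_const_lt hlt).exists
        exact ⟨n, hn.le⟩
    · refine ⟨fun n => n, Nat.mono_cast, fun n => ?_, fun x _ => exists_nat_ge x⟩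
      obtain ⟨y, hy, hny⟩ := not_bddAbove_iff.1 hbdd n
      exact hlow y hy _ hny.le
  calc volume.withDensity (fun τ => (σ.rate i τ : ℝ≥0∞)) (S ∩ Set.Ici 0)
      ≤ volume.withDensity (fun τ => (σ.rate i τ : ℝ≥0∞)) (⋃ n, Set.Icc 0 (u n)) := by
        refine measure_mono fun x hx => ?_
        obtain ⟨n, hn⟩ := huS x hx.1
        exact Set.mem_iUnion.2 ⟨n, hx.2, hn⟩
    _ = ⨆ n, volume.withDensity (fun τ => (σ.rate i τ : ℝ≥0∞)) (Set.Icc 0 (u n)) := by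
        refine Directed.measure_iUnion ?_
        exact (directed_of_isDirected_le (f := fun n => Set.Icc 0 (u n))
          (fun a b h => Set.Icc_subset_Icc_right (hmono h)))
    _ ≤ _ := iSup_le fun n => by rw [← workDone_eq_measure]; exact (hu n).le

theorem workDone_ne_top (i : Fin I.n) (t : ℝ) : workDone (σ.rate i) t ≠ ∞ :=
  ((σ.workDone_le_size i t).trans_lt ENNReal.ofReal_lt_top).ne

theorem le_completionTime {i : Fin I.n} {t : ℝ}
    (h : workDone (σ.rate i) t < ENNReal.ofReal (I.size i)) :
    ENNReal.ofReal t ≤ σ.completionTime i := by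
  refine le_iInf₂ fun s hs => ENNReal.ofReal_le_ofReal ?_
  by_contra! hst
  exact absurd (hs.trans (workDone_mono _ hst.le)) (not_le.2 h)

theorem lt_completionTime {i : Fin I.n} {t : ℝ} (ht : 0 ≤ t)
    (h : workDone (σ.rate i) t < ENNReal.ofReal (I.size i)) :
    ENNReal.ofReal t < σ.completionTime i := by
  -- The completion time is an infimum, so strictness needs the work to stay below the size slightly
  -- beyond `t`.
  obtain ⟨s, hts, hs⟩ := exists_gt_workDone_lt (lt_add_one t) (σ.workDone_ne_top i _) h
  exact ((ENNReal.ofReal_lt_ofReal_iff (ht.trans_lt hts)).2 hts).trans_le (σ.le_completionTime hs)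

theorem completions_eq_empty {t : ℝ} (h : ∀ i, ENNReal.ofReal t < σ.completionTime i) :
    σ.completions t = ∅ := by
  ext e
  simp only [completions, Set.mem_ofPred_eq, Set.mem_empty_iff_false, iff_false, not_exists,
    not_and]
  exact fun i hi => absurd hi (not_le.2 (h i))

/-- If at least `N` jobs are active throughout `[a, b]`, they contribute `N * (b - a)` to the
total flow time. -/
theorem mul_le_totalFlowTime {a b : ℝ} {N : ℝ≥0∞}
    (h : ∀ t ∈ Set.Icc a b,
      N ≤ ∑ i, if I.release i ≤ t ∧ ENNReal.ofReal t ≤ σ.completionTime i then 1 else 0) :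
    N * ENNReal.ofReal (b - a) ≤ σ.totalFlowTime := by
  set A : Fin I.n → Set ℝ := fun i =>
    {t | I.release i ≤ t ∧ ENNReal.ofReal t ≤ σ.completionTime i} with hA
  have hmeas : ∀ i, MeasurableSet (A i) := fun i =>
    (measurableSet_Ici).inter (ENNReal.measurable_ofReal measurableSet_Iic)
  have hvol : ∀ i, volume (A i) ≤ σ.flowTime i := by
    intro i
    by_cases htop : σ.completionTime i = ∞
    · simp [flowTime, htop]
    · calc volume (A i) ≤ volume (Set.Icc (I.release i) (σ.completionTime i).toReal) :=
            measure_mono fun t ht => ⟨ht.1, (ENNReal.ofReal_le_iff_le_toReal htop).1 ht.2⟩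
        _ = σ.flowTime i := by
            rw [Real.volume_Icc, ENNReal.ofReal_sub _ (I.release_nonneg i),
              ENNReal.ofReal_toReal htop, flowTime]
  calc N * ENNReal.ofReal (b - a) = ∫⁻ _ in Set.Icc a b, N := by
        rw [setLIntegral_const, Real.volume_Icc]
    _ ≤ ∫⁻ t in Set.Icc a b, ∑ i, (A i).indicator 1 t := by
        refine setLIntegral_mono' measurableSet_Icc fun t ht => (h t ht).trans_eq ?_
        refine Finset.sum_congr rfl fun i _ => ?_
        simp [Set.indicator, hA]
    _ ≤ ∫⁻ t, ∑ i, (A i).indicator 1 t := setLIntegral_le_lintegral _ _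
    _ = ∑ i, volume (A i) := by
        rw [lintegral_finsetSum _ (fun i _ => measurable_one.indicator (hmeas i))]
        exact Finset.sum_congr rfl fun i _ => lintegral_indicator_one (hmeas i)
    _ ≤ σ.totalFlowTime := Finset.sum_le_sum fun i _ => hvol i

/-- A linear bound of the speed by the power bounds the work done during `(a, b]`. -/
theorem sum_workDone_le {α lam κ : ℝ} (hlam : 0 ≤ lam) (hκ : 0 ≤ κ)
    (hs : ∀ s : ℝ, 0 ≤ s → s ≤ lam + κ * s ^ α) (hα : 0 ≤ α) {a b : ℝ} (ha : 0 ≤ a) (hab : a ≤ b) :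
    ∑ i, workDone (σ.rate i) b ≤ ∑ i, workDone (σ.rate i) a
      + ENNReal.ofReal (lam * (b - a)) + ENNReal.ofReal κ * σ.energy α := by
  have hsplit : ∀ i, workDone (σ.rate i) b
      = workDone (σ.rate i) a + ∫⁻ τ in Set.Ioc a b, (σ.rate i τ : ℝ≥0∞) := fun i => by
    rw [workDone, workDone, ← Set.Icc_union_Ioc_eq_Icc ha hab, lintegral_union measurableSet_Ioc]
    exact Set.disjoint_left.2 fun x hx hx' => absurd hx.2 (not_le.2 hx'.1)
  simp_rw [hsplit, Finset.sum_add_distrib, add_assoc]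
  gcongr
  rw [← lintegral_finsetSum _ (fun i _ => (σ.measurable_rate i).coe_nnreal_ennreal)]
  calc ∫⁻ τ in Set.Ioc a b, ∑ i, (σ.rate i τ : ℝ≥0∞)
      ≤ ∫⁻ τ in Set.Ioc a b, (ENNReal.ofReal lam + ENNReal.ofReal κ * (σ.speed τ : ℝ≥0∞) ^ α) := by
        refine lintegral_mono fun τ => ?_
        have h1 := hs (σ.speed τ) (σ.speed τ).2
        have h2 : ∑ i, (σ.rate i τ : ℝ≥0∞) = ENNReal.ofReal (σ.speed τ : ℝ) := by
          rw [ENNReal.ofReal_coe_nnreal, speed, ENNReal.ofNNReal_finsetSum]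
        rw [h2]
        refine (ENNReal.ofReal_le_ofReal h1).trans_eq ?_
        rw [ENNReal.ofReal_add hlam (by positivity), ENNReal.ofReal_mul hκ,
          ← ENNReal.ofReal_rpow_of_nonneg (NNReal.coe_nonneg _) hα, ENNReal.ofReal_coe_nnreal]
    _ = ENNReal.ofReal (lam * (b - a))
        + ENNReal.ofReal κ * ∫⁻ τ in Set.Ioc a b, (σ.speed τ : ℝ≥0∞) ^ α := by
        rw [lintegral_add_left measurable_const, setLIntegral_const, Real.volume_Ioc,
          ENNReal.ofReal_mul hlam, lintegral_const_mul' _ _ ENNReal.ofReal_ne_top]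
    _ ≤ _ := by
        gcongr
        exact lintegral_mono_set fun x hx => ha.trans hx.1.le

end Schedule

/-! ### Unit-speed schedules as upper bounds for the optimum -/

theorem workDone_indicator_Ico {a b : ℝ} (ha : 0 ≤ a) (t : ℝ) :
    workDone ((Set.Ico a b).indicator 1) t = ENNReal.ofReal (min t b - a) := by
  have h : (fun τ => (((Set.Ico a b).indicator 1 τ : ℝ≥0) : ℝ≥0∞))
      = (Set.Ico a b).indicator 1 := by
    ext τ
    by_cases hτ : τ ∈ Set.Ico a b <;> simp [hτ]
  rw [workDone, h, lintegral_indicator_one measurableSet_Ico,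
    Measure.restrict_apply measurableSet_Ico]
  refine le_antisymm ?_ ?_
  · rw [← Real.volume_Icc]
    exact measure_mono fun x hx => ⟨hx.1.1, le_min hx.2.2 hx.1.2.le⟩
  · rw [← Real.volume_Ico]
    exact measure_mono fun x hx => ⟨⟨hx.1, hx.2.trans_le (min_le_right _ _)⟩,
      ha.trans hx.1, (hx.2.trans_le (min_le_left _ _)).le⟩

namespace Schedule

variable {I : Instance}

/-- The nonpreemptive schedule that processes each job `i` at unit speed from time `start i` on. -/
def ofStart (start : Fin I.n → ℝ) (hstart : ∀ i, I.release i ≤ start i) : Schedule I where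
  rate i := (Set.Ico (start i) (start i + I.size i)).indicator 1
  measurable_rate i := measurable_one.indicator measurableSet_Ico
  active_of_rate_ne_zero i t ht := by
    have hmem : t ∈ Set.Ico (start i) (start i + I.size i) := by
      by_contra h
      exact ht (Set.indicator_of_notMem h _)
    refine ⟨(hstart i).trans hmem.1, ?_⟩
    rw [workDone_indicator_Ico ((I.release_nonneg i).trans (hstart i))]
    refine (ENNReal.ofReal_lt_ofReal_iff (I.size_pos i)).2 ?_
    have := min_le_left t (start i + I.size i)
    linarith [hmem.2]

theorem completionTime_ofStart_le (start : Fin I.n → ℝ) (hstart : ∀ i, I.release i ≤ start i)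
    (i : Fin I.n) :
    (ofStart start hstart).completionTime i ≤ ENNReal.ofReal (start i + I.size i) := by
  refine iInf₂_le (start i + I.size i) ?_
  have h := workDone_indicator_Ico (b := start i + I.size i)
    ((I.release_nonneg i).trans (hstart i)) (start i + I.size i)
  rw [min_self, add_sub_cancel_left] at h
  exact h.ge

theorem energy_ofStart_le {α : ℝ} (hα : 1 ≤ α) (start : Fin I.n → ℝ)
    (hstart : ∀ i, I.release i ≤ start i)
    (hdisj : ∀ i j, i ≠ j →
      start i + I.size i ≤ start j ∨ start j + I.size j ≤ start i) :
    (ofStart start hstart).energy α ≤ ∑ i, ENNReal.ofReal (I.size i) := by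
  have hspeed : ∀ t, (ofStart start hstart).speed t ≤ 1 := by
    intro t
    by_cases h : ∃ i, t ∈ Set.Ico (start i) (start i + I.size i)
    · obtain ⟨i, hi⟩ := h
      rw [speed, Finset.sum_eq_single i]
      · exact (Set.indicator_of_mem hi _).le
      · intro j _ hj
        refine Set.indicator_of_notMem (fun hmem => ?_) _
        rcases hdisj i j hj.symm with h | h
        · exact absurd (hi.2.trans_le h) (not_lt.2 hmem.1)
        · exact absurd (hmem.2.trans_le h) (not_lt.2 hi.1)
      · simp
    · push Not at h
      rw [speed, Finset.sum_eq_zero]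
      · exact zero_le_one
      · exact fun j _ => Set.indicator_of_notMem (h j) _
  calc (ofStart start hstart).energy α
      ≤ ∫⁻ t in Set.Ici (0 : ℝ), ∑ i, ((ofStart start hstart).rate i t : ℝ≥0∞) := by
        refine lintegral_mono fun t => ?_
        rw [← ENNReal.ofNNReal_finsetSum]
        exact ENNReal.rpow_le_self_of_le_one (by exact_mod_cast hspeed t) hα
    _ = ∑ i, ∫⁻ t in Set.Ici (0 : ℝ), ((ofStart start hstart).rate i t : ℝ≥0∞) :=
        lintegral_finsetSum _
          (fun i _ => ((ofStart start hstart).measurable_rate i).coe_nnreal_ennreal)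
    _ ≤ ∑ i, ENNReal.ofReal (I.size i) := by
        refine Finset.sum_le_sum fun i _ => ?_
        refine (setLIntegral_le_lintegral _ _).trans ?_
        have h : (fun τ => (((ofStart start hstart).rate i τ : ℝ≥0) : ℝ≥0∞))
            = (Set.Ico (start i) (start i + I.size i)).indicator 1 := by
          ext τ
          by_cases hτ : τ ∈ Set.Ico (start i) (start i + I.size i) <;> simp [ofStart, hτ]
        rw [h, lintegral_indicator_one measurableSet_Ico, Real.volume_Ico, add_sub_cancel_left]

end Schedule

/-- The size counts twice: once as processing time in the flow, once as energy, since `s ^ α ≤ s`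
for speeds at most `1`. -/
theorem optCost_le_of_start {I : Instance} {α : ℝ} (hα : 1 ≤ α) (start : Fin I.n → ℝ)
    (hstart : ∀ i, I.release i ≤ start i)
    (hdisj : ∀ i j, i ≠ j →
      start i + I.size i ≤ start j ∨ start j + I.size j ≤ start i) :
    optCost α I ≤ ENNReal.ofReal (∑ i, (start i - I.release i + 2 * I.size i)) := by
  refine (iInf_le _ (Schedule.ofStart start hstart)).trans ?_
  have hsz := fun i => (I.size_pos i).le
  have hst := fun i => sub_nonneg.2 (hstart i)
  rw [ENNReal.ofReal_sum_of_nonneg (fun i _ => add_nonneg (hst i) (by linarith [hsz i]))]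
  refine (add_le_add_right (Schedule.energy_ofStart_le hα start hstart hdisj) _).trans ?_
  rw [Schedule.totalFlowTime, ← Finset.sum_add_distrib]
  refine Finset.sum_le_sum fun i _ => ?_
  calc (Schedule.ofStart start hstart).flowTime i + ENNReal.ofReal (I.size i)
      ≤ ENNReal.ofReal (start i + I.size i - I.release i) + ENNReal.ofReal (I.size i) := by
        rw [ENNReal.ofReal_sub _ (I.release_nonneg i)]
        gcongr
        exact tsub_le_tsub_right (Schedule.completionTime_ofStart_le start hstart i) _
    _ = _ := by
        rw [← ENNReal.ofReal_add (by linarith [hsz i, hst i]) (hsz i)]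
        congr 1
        ring

/-! ### Positive cost, and instances the algorithm cannot distinguish -/

theorem Schedule.cost_ne_zero {I : Instance} (σ : Schedule I) (i : Fin I.n) {α : ℝ} (hα : 0 < α) :
    σ.cost α ≠ 0 := by
  intro h
  obtain ⟨hflow, hen⟩ := add_eq_zero.1 h
  have hmeas : Measurable fun t => (σ.speed t : ℝ≥0∞) := by
    have : Measurable σ.speed := Finset.measurable_sum _ fun i _ => σ.measurable_rate i
    exact this.coe_nnreal_ennreal
  have hspeed := (lintegral_eq_zero_iff (hmeas.pow_const α)).1 hen
  have hwork : ∀ t, workDone (σ.rate i) t = 0 := by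
    intro t
    refine (lintegral_eq_zero_iff (σ.measurable_rate i).coe_nnreal_ennreal).2 ?_
    have h' := ae_restrict_of_ae_restrict_of_subset
      (Set.Icc_subset_Ici_self : Set.Icc (0 : ℝ) t ⊆ Set.Ici 0) hspeed
    filter_upwards [h'] with s hs
    have h0 : σ.speed s = 0 := by
      simpa [ENNReal.rpow_eq_zero_iff_of_pos hα] using hs
    have := (Finset.sum_eq_zero_iff.1 h0) i (Finset.mem_univ _)
    simp [this]
  have htop : σ.completionTime i = ∞ := by
    refine iInf₂_eq_top.2 fun t ht => ?_
    rw [hwork t, nonpos_iff_eq_zero, ENNReal.ofReal_eq_zero] at ht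
    exact absurd (I.size_pos i) (not_lt.2 ht)
  have := Finset.sum_eq_zero_iff.1 hflow i (Finset.mem_univ _)
  simp [flowTime, htop] at this

/-- Suppose `J` extends `I` by jobs released from time `T` on, and the common jobs are, in both
sequences, larger than the work that they receive by time `T` when the algorithm runs on `I`.
Then the algorithm treats the common jobs alike until time `T`. -/
theorem NonclairvoyantAlgorithm.workDone_eq_of_extends (A : NonclairvoyantAlgorithm)
    {I J : Instance} {T : ℝ} (f : Fin I.n → Fin J.n) (hf : ∀ i, (f i : ℕ) = i)
    (hrel : ∀ i, J.release (f i) = I.release i)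
    (hnew : ∀ j, j ∉ Set.range f → T ≤ J.release j)
    (hI : ∀ i, workDone ((A.run I).rate i) T < ENNReal.ofReal (I.size i))
    (hJ : ∀ i, workDone ((A.run I).rate i) T < ENNReal.ofReal (J.size (f i)))
    (i : Fin I.n) :
    workDone ((A.run J).rate (f i)) T = workDone ((A.run I).rate i) T := by
  have harr : ∀ t < T, I.arrivals t = J.arrivals t := by
    intro t ht
    ext e
    constructor
    · rintro ⟨i, hi, rfl⟩
      exact ⟨f i, by rwa [hrel], by rw [hf, hrel]⟩
    · rintro ⟨j, hj, rfl⟩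
      by_cases hr : j ∈ Set.range f
      · obtain ⟨i, rfl⟩ := hr
        exact ⟨i, by rwa [← hrel], by rw [hf, hrel]⟩
      · exact absurd (hnew j hr) (not_le.2 (hj.trans_lt ht))
  have hIc : ∀ t, 0 ≤ t → t < T → (A.run I).completions t = ∅ := fun t ht htT =>
    Schedule.completions_eq_empty _ fun i =>
      Schedule.lt_completionTime _ ht ((workDone_mono _ htT.le).trans_lt (hI i))
  have hrate : ∀ t, 0 ≤ t → t < T → (A.run J).completions t = ∅ → ∀ i,
      (A.run J).rate (f i) t = (A.run I).rate i t := fun t ht htT hc i =>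
    (A.nonclairvoyant I J t ht (harr t htT) (by rw [hIc t ht htT, hc]) i (f i) (hf i).symm).symm
  have hJc : ∀ t, 0 ≤ t → t < T → (A.run J).completions t = ∅ := by
    intro t ht htT
    refine Schedule.completions_eq_empty _ fun j => ?_
    -- Take the first completion `τ` in the run on `J`. Before `τ` both runs have seen the same
    -- events, so job `m` has received by `τ` only what the run on `I` gives it (nothing, if `m` is
    -- new). That is less than its size, so it cannot complete at `τ`.
    obtain ⟨m, -, hm⟩ := Finset.exists_min_image Finset.univ
      (fun j => (A.run J).completionTime j) ⟨j, Finset.mem_univ j⟩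
    refine lt_of_lt_of_le ?_ (hm j (Finset.mem_univ j))
    by_contra! hle
    have hτtop : (A.run J).completionTime m ≠ ∞ := (hle.trans_lt ENNReal.ofReal_lt_top).ne
    set τ := ((A.run J).completionTime m).toReal with hτ
    have hτ0 : 0 ≤ τ := ENNReal.toReal_nonneg
    have hτT : τ < T := (ENNReal.toReal_le_of_le_ofReal ht hle).trans_lt htT
    have hbefore : ∀ s, 0 ≤ s → s < τ → (A.run J).completions s = ∅ := fun s hs hsτ =>
      Schedule.completions_eq_empty _ fun j => by
        refine lt_of_lt_of_le ?_ (hm j (Finset.mem_univ j))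
        rwa [ENNReal.ofReal_lt_iff_lt_toReal hs hτtop]
    have hwork : workDone ((A.run J).rate m) τ < ENNReal.ofReal (J.size m) := by
      by_cases hr : m ∈ Set.range f
      · obtain ⟨i, rfl⟩ := hr
        rw [workDone_congr fun s hs hsτ => hrate s hs (hsτ.trans hτT) (hbefore s hs hsτ) i]
        exact (workDone_mono _ hτT.le).trans_lt (hJ i)
      · rw [workDone_eq_zero_of_forall_lt fun s hs =>
          Schedule.rate_eq_zero_of_lt_release _ ((hs.trans hτT).trans_le (hnew m hr))]
        exact ENNReal.ofReal_pos.2 (J.size_pos m)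
    have := Schedule.lt_completionTime _ hτ0 hwork
    rw [hτ, ENNReal.ofReal_toReal hτtop] at this
    exact this.false
  exact workDone_congr fun s hs hsT => hrate s hs hsT (hJc s hs hsT) i

/-! ### Tangent-line bound and the two adversarial instances -/

/-- Bernoulli's inequality for `s / lam`, i.e. the tangent to `s ^ α` at `lam`, with a favourable
term `lam / α` dropped. -/
theorem le_add_rpow_div {α lam s : ℝ} (hα : 1 ≤ α) (hlam : 0 < lam) (hs : 0 ≤ s) :
    s ≤ lam + (α * lam ^ (α - 1))⁻¹ * s ^ α := by
  have hb := one_add_mul_self_le_rpow_one_add (s := s / lam - 1) (p := α)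
    (by linarith [div_nonneg hs hlam.le]) hα
  rw [add_sub_cancel, Real.div_rpow hs hlam.le] at hb
  have hpow : lam ^ α = lam * lam ^ (α - 1) := by
    rw [Real.rpow_sub_one hlam.ne', mul_div_cancel₀ _ hlam.ne']
  have hp : 0 < lam ^ (α - 1) := Real.rpow_pos_of_pos hlam _
  have hα0 : 0 < α := by linarith
  rw [hpow] at hb
  have h2 : s / lam ≤ 1 + s ^ α / (lam * lam ^ (α - 1)) / α := by
    rw [← sub_le_iff_le_add', le_div_iff₀ hα0]
    linarith
  calc s = lam * (s / lam) := by field_simp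
    _ ≤ lam * (1 + s ^ α / (lam * lam ^ (α - 1)) / α) := by gcongr
    _ = _ := by field_simp

/-- `k` jobs of equal size released at time `0`. -/
def burst (k : ℕ) (M : ℝ) (hM : 0 < M) : Instance where
  n := k
  release _ := 0
  size _ := M
  release_nonneg _ := le_rfl
  release_mono := monotone_const
  size_pos _ := hM

/-- `k` jobs released at time `0`, with sizes `w i + 1`, followed by `L` unit jobs released one
per time unit from time `T` on. -/
def burstThenStream {k : ℕ} (L : ℕ) {T : ℝ} (hT : 0 ≤ T) {w : Fin k → ℝ} (hw : ∀ i, 0 ≤ w i) :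
    Instance where
  n := k + L
  release i := if (i : ℕ) < k then 0 else T + ((i : ℕ) - k : ℕ)
  size := Fin.append (fun i => w i + 1) (fun _ => 1)
  release_nonneg i := by split_ifs <;> positivity
  release_mono i j hij := by
    have h : (i : ℕ) ≤ j := hij
    dsimp only
    split_ifs with h1 h2
    · exact le_rfl
    · positivity
    · omega
    · gcongr
  size_pos := by
    refine Fin.addCases (fun i => ?_) (fun j => ?_)
    · rw [Fin.append_left]
      linarith [hw i]
    · rw [Fin.append_right]
      exact one_pos

section burstThenStream

variable {k : ℕ} (L : ℕ) {T : ℝ} (hT : 0 ≤ T) {w : Fin k → ℝ} (hw : ∀ i, 0 ≤ w i)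

theorem burstThenStream_release_castAdd (i : Fin k) :
    (burstThenStream L hT hw).release (Fin.castAdd L i) = 0 := by
  simp [burstThenStream]

theorem burstThenStream_release_natAdd (j : Fin L) :
    (burstThenStream L hT hw).release (Fin.natAdd k j) = T + (j : ℕ) := by
  simp [burstThenStream]

theorem burstThenStream_size_castAdd (i : Fin k) :
    (burstThenStream L hT hw).size (Fin.castAdd L i) = w i + 1 :=
  Fin.append_left (fun i => w i + 1) (fun _ : Fin L => (1 : ℝ)) i

theorem burstThenStream_size_natAdd (j : Fin L) :
    (burstThenStream L hT hw).size (Fin.natAdd k j) = 1 :=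
  Fin.append_right (fun i => w i + 1) (fun _ : Fin L => (1 : ℝ)) j

end burstThenStream

theorem optCost_burst_le {α : ℝ} (hα : 1 ≤ α) (k : ℕ) {M : ℝ} (hM : 0 < M) :
    optCost α (burst k M hM) ≤ ENNReal.ofReal (k * (k + 1) * M) := by
  refine (optCost_le_of_start (I := burst k M hM) hα (fun i : Fin k => (i : ℕ) * M)
    (fun i => by change (0 : ℝ) ≤ _; positivity) ?_).trans (ENNReal.ofReal_le_ofReal ?_)
  · intro i j hij
    change Fin k at i j
    have key : ∀ a b : Fin k, a < b → ((a : ℕ) : ℝ) * M + M ≤ ((b : ℕ) : ℝ) * M := by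
      intro a b hab
      have h : ((a : ℕ) : ℝ) + 1 ≤ ((b : ℕ) : ℝ) := by exact_mod_cast hab
      nlinarith
    exact (lt_or_gt_of_ne hij).imp (key i j) (key j i)
  · have hle : ∀ i ∈ (Finset.univ : Finset (Fin k)),
        ((i : ℕ) : ℝ) * M - 0 + 2 * M ≤ (k + 1) * M := by
      intro i _
      have h : ((i : ℕ) : ℝ) + 1 ≤ k := by exact_mod_cast i.2
      nlinarith
    refine (Finset.sum_le_card_nsmul _ _ _ hle).trans_eq ?_
    simp
    ring

/-- Burst jobs other than `m` run back to back in index order, within `[0, T]` by `hm`; each stream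
job starts on release; `m` starts at `T + L`. Of the term `3 * L`, the stream jobs pay `2 * L` and
the waiting of `m` pays `L`. -/
theorem optCost_burstThenStream_le {α : ℝ} (hα : 1 ≤ α) {k : ℕ} (L : ℕ) {T : ℝ} (hT : 0 ≤ T)
    {w : Fin k → ℝ} (hw : ∀ i, 0 ≤ w i) (m : Fin k)
    (hm : ∑ i, (w i + 1) - (w m + 1) ≤ T) :
    optCost α (burstThenStream L hT hw)
      ≤ ENNReal.ofReal (k * T + 3 * L + 2 * (∑ i, w i + k)) := by
  have hw1 : ∀ i, 0 ≤ w i + 1 := fun i => by linarith [hw i]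
  set S : Fin k → ℝ := fun i =>
    if i = m then T + L else ∑ j ∈ Finset.univ.filter (fun j => j < i ∧ j ≠ m), (w j + 1) with hS
  have hSm : S m = T + L := by simp [hS]
  have hSi : ∀ i, i ≠ m →
      S i = ∑ j ∈ Finset.univ.filter (fun j => j < i ∧ j ≠ m), (w j + 1) := fun i hi => by
    simp [hS, hi]
  have hSend : ∀ i, i ≠ m →
      S i + (w i + 1) = ∑ j ∈ insert i (Finset.univ.filter (fun j => j < i ∧ j ≠ m)), (w j + 1) :=
    fun i hi => by
      rw [Finset.sum_insert (by simp), hSi i hi, add_comm]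
  have hST : ∀ i, i ≠ m → S i + (w i + 1) ≤ T := by
    intro i hi
    refine le_trans ?_ hm
    rw [hSend i hi, ← Finset.sum_erase_eq_sub (Finset.mem_univ m)]
    refine Finset.sum_le_sum_of_subset_of_nonneg (fun x hx => ?_) (fun x _ _ => hw1 x)
    rcases Finset.mem_insert.1 hx with rfl | hx
    · simpa using hi
    · simpa using (Finset.mem_filter.1 hx).2.2
  have hSlt : ∀ i j, i ≠ m → j ≠ m → i < j → S i + (w i + 1) ≤ S j := by
    intro i j hi hj hij
    rw [hSend i hi, hSi j hj]
    refine Finset.sum_le_sum_of_subset_of_nonneg (fun x hx => ?_) (fun x _ _ => hw1 x)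
    rcases Finset.mem_insert.1 hx with rfl | hx
    · simpa using ⟨hij, hi⟩
    · have := (Finset.mem_filter.1 hx).2
      simpa using ⟨this.1.trans hij, this.2⟩
  have hS0 : ∀ i, 0 ≤ S i := by
    intro i
    by_cases hi : i = m
    · rw [hi, hSm]; positivity
    · rw [hSi i hi]; exact Finset.sum_nonneg fun j _ => hw1 j
  have hnew : ∀ j : Fin L, T + ((j : ℕ) : ℝ) + 1 ≤ T + L := fun j => by
    have : ((j : ℕ) : ℝ) + 1 ≤ L := by exact_mod_cast j.2
    linarith
  have hnew' : ∀ j j' : Fin L, j < j' → T + ((j : ℕ) : ℝ) + 1 ≤ T + ((j' : ℕ) : ℝ) :=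
    fun j j' h => by
      have : ((j : ℕ) : ℝ) + 1 ≤ ((j' : ℕ) : ℝ) := by exact_mod_cast h
      linarith
  have hon : ∀ (i : Fin k) (j : Fin L),
      S i + (w i + 1) ≤ T + ((j : ℕ) : ℝ) ∨ T + ((j : ℕ) : ℝ) + 1 ≤ S i := by
    intro i j
    by_cases hi : i = m
    · right; rw [hi, hSm]; exact hnew j
    · left; exact (hST i hi).trans (by simp)
  refine (optCost_le_of_start (I := burstThenStream L hT hw) hα
    (Fin.append S (fun j : Fin L => T + ((j : ℕ) : ℝ)) : Fin (k + L) → ℝ) ?_ ?_).trans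
    (ENNReal.ofReal_le_ofReal ?_)
  · refine Fin.addCases (fun i => ?_) (fun j => ?_)
    · rw [burstThenStream_release_castAdd, Fin.append_left]
      exact hS0 i
    · rw [burstThenStream_release_natAdd, Fin.append_right]
  · refine Fin.addCases (fun i => Fin.addCases (fun i' => ?_) (fun j' => ?_))
      (fun j => Fin.addCases (fun i' => ?_) (fun j' => ?_))
    · intro hne
      have hne' : i ≠ i' := fun h => hne (by rw [h])
      rw [burstThenStream_size_castAdd, burstThenStream_size_castAdd, Fin.append_left,
        Fin.append_left]
      by_cases hi : i = m
      · right
        have hi' : i' ≠ m := fun h => hne' (hi.trans h.symm)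
        rw [hi, hSm]
        exact (hST i' hi').trans (by simp)
      by_cases hi' : i' = m
      · left
        rw [hi', hSm]
        exact (hST i hi).trans (by simp)
      exact (lt_or_gt_of_ne hne').imp (hSlt i i' hi hi') (hSlt i' i hi' hi)
    · intro _
      rw [burstThenStream_size_castAdd, burstThenStream_size_natAdd, Fin.append_left,
        Fin.append_right]
      exact hon i j'
    · intro _
      rw [burstThenStream_size_castAdd, burstThenStream_size_natAdd, Fin.append_left,
        Fin.append_right]
      exact (hon i' j).symm
    · intro hne
      have hne' : j ≠ j' := fun h => hne (by rw [h])
      rw [burstThenStream_size_natAdd, burstThenStream_size_natAdd, Fin.append_right,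
        Fin.append_right]
      exact (lt_or_gt_of_ne hne').imp (hnew' j j') (hnew' j' j)
  · refine (Fin.sum_univ_add (a := k) (b := L) _).trans_le ?_
    simp only [burstThenStream_size_castAdd, burstThenStream_size_natAdd, Fin.append_left,
      Fin.append_right, burstThenStream_release_castAdd, burstThenStream_release_natAdd]
    have hold : ∀ i, S i - 0 + 2 * (w i + 1)
        ≤ T + (w i + 1) + if i = m then L + (w m + 1) else 0 := by
      intro i
      by_cases hi : i = m
      · rw [if_pos hi, hi, hSm]; linarith
      · rw [if_neg hi]; linarith [hST i hi]
    have hsum := Finset.sum_le_sum fun i (_ : i ∈ Finset.univ) => hold i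
    have hwm : w m ≤ ∑ i, w i :=
      Finset.single_le_sum (fun i _ => hw i) (Finset.mem_univ m)
    have hk : (1 : ℝ) ≤ k := by exact_mod_cast (Fin.pos m)
    simp only [Finset.sum_add_distrib, Finset.sum_ite_eq', Finset.mem_univ, if_true,
      Finset.sum_const, Finset.card_univ, Fintype.card_fin, nsmul_eq_mul, sub_self] at hsum ⊢
    linarith

/-! ### Consequences of competitiveness -/

theorem NonclairvoyantAlgorithm.IsCompetitive.one_le {A : NonclairvoyantAlgorithm} {α C : ℝ}
    (hα : 1 ≤ α) (hA : A.IsCompetitive α C) : 1 ≤ C := by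
  set I := burst 1 1 one_pos
  have hopt : optCost α I ≠ ∞ :=
    ((optCost_burst_le hα 1 one_pos).trans_lt ENNReal.ofReal_lt_top).ne
  have h0 : (A.run I).cost α ≠ 0 :=
    (A.run I).cost_ne_zero (0 : Fin 1) (by linarith)
  have htop : (A.run I).cost α ≠ ∞ :=
    ((hA I).trans_lt (ENNReal.mul_lt_top ENNReal.ofReal_lt_top hopt.lt_top)).ne
  by_contra! hC
  have hlt : ENNReal.ofReal C < 1 := by
    rw [← ENNReal.ofReal_one]; exact (ENNReal.ofReal_lt_ofReal_iff one_pos).2 hC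
  have hle : (A.run I).cost α ≤ ENNReal.ofReal C * (A.run I).cost α :=
    (hA I).trans (mul_le_mul_right (iInf_le _ _) _)
  have := ENNReal.mul_lt_mul_left h0 htop hlt
  rw [one_mul] at this
  exact absurd hle (not_le.2 this)

theorem NonclairvoyantAlgorithm.IsCompetitive.cost_le {A : NonclairvoyantAlgorithm} {α C : ℝ}
    (hA : A.IsCompetitive α C) (hC : 0 ≤ C) {I : Instance} {B : ℝ}
    (hB : optCost α I ≤ ENNReal.ofReal B) :
    (A.run I).cost α ≤ ENNReal.ofReal (C * B) := by
  rw [ENNReal.ofReal_mul hC]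
  exact (hA I).trans (mul_le_mul_right hB _)

/-- The work done during `(a, b]` by a competitive algorithm, bounded through its energy. -/
theorem NonclairvoyantAlgorithm.IsCompetitive.sum_toReal_workDone_le
    {A : NonclairvoyantAlgorithm} {α C : ℝ} (hα : 1 ≤ α)
    (hA : A.IsCompetitive α C) (hC : 0 ≤ C) {I : Instance} {B : ℝ} (hB0 : 0 ≤ B)
    (hB : optCost α I ≤ ENNReal.ofReal B) {lam : ℝ} (hlam : 0 < lam)
    {a b : ℝ} (ha : 0 ≤ a) (hab : a ≤ b) :
    ∑ i, (workDone ((A.run I).rate i) b).toReal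
      ≤ ∑ i, (workDone ((A.run I).rate i) a).toReal + lam * (b - a)
        + (α * lam ^ (α - 1))⁻¹ * (C * B) := by
  have hκ : 0 ≤ (α * lam ^ (α - 1))⁻¹ := by positivity
  have hab' := sub_nonneg.2 hab
  have h := (A.run I).sum_workDone_le (α := α) hlam.le hκ
    (fun s hs => le_add_rpow_div hα hlam hs) (by linarith) ha hab
  have hen : (A.run I).energy α ≤ ENNReal.ofReal (C * B) :=
    le_add_self.trans (hA.cost_le hC hB)
  have hsum : ∀ t, ∑ i, workDone ((A.run I).rate i) t
      = ENNReal.ofReal (∑ i, (workDone ((A.run I).rate i) t).toReal) := fun t => by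
    rw [ENNReal.ofReal_sum_of_nonneg fun i _ => ENNReal.toReal_nonneg]
    exact Finset.sum_congr rfl fun i _ =>
      (ENNReal.ofReal_toReal ((A.run I).workDone_ne_top i t)).symm
  have hnn : 0 ≤ ∑ i, (workDone ((A.run I).rate i) a).toReal :=
    Finset.sum_nonneg fun i _ => ENNReal.toReal_nonneg
  rw [hsum, hsum] at h
  have h2 := h.trans (add_le_add_right (mul_le_mul_right hen _) _)
  rw [← ENNReal.ofReal_mul hκ, ← ENNReal.ofReal_add hnn (by positivity),
    ← ENNReal.ofReal_add (by positivity) (by positivity)] at h2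
  exact (ENNReal.ofReal_le_ofReal_iff (by positivity)).1 h2

/-! ### Active jobs during the stream -/

theorem le_card_filter_add_le {L : ℕ} {T t : ℝ} (ht : t ≤ T + L) :
    t - T ≤ ∑ j : Fin L, if T + ((j : ℕ) : ℝ) ≤ t then (1 : ℝ) else 0 := by
  have h1 : ∑ j : Fin L, (if T + ((j : ℕ) : ℝ) ≤ t then (1 : ℝ) else 0)
      = ∑ j ∈ Finset.range L, if T + (j : ℝ) ≤ t then (1 : ℝ) else 0 :=
    Fin.sum_univ_eq_sum_range (fun j => if T + (j : ℝ) ≤ t then (1 : ℝ) else 0) L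
  rw [h1, ← Finset.sum_filter, Finset.sum_const, nsmul_eq_mul, mul_one]
  refine (Nat.le_ceil (t - T)).trans ?_
  have hsub : Finset.range ⌈t - T⌉₊ ⊆ (Finset.range L).filter fun j : ℕ => T + (j : ℝ) ≤ t := by
    intro j hj
    have hj' : (j : ℝ) < t - T := Nat.lt_ceil.1 (Finset.mem_range.1 hj)
    have hjL : (j : ℝ) < L := by linarith
    exact Finset.mem_filter.2 ⟨Finset.mem_range.2 (by exact_mod_cast hjL), by linarith⟩
  have := Finset.card_le_card hsub
  rw [Finset.card_range] at this
  exact_mod_cast this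

/-- If the burst jobs of `burstThenStream` all have one unit of work left at time `T`, then at each
later time of the stream the number of active jobs is at least `k` minus the amount by which the
processor has been ahead of unit speed since time `T`. -/
theorem le_card_active_burstThenStream {k L : ℕ} {T : ℝ} (hT : 0 ≤ T) {w : Fin k → ℝ}
    (hw : ∀ i, 0 ≤ w i) (σ : Schedule (burstThenStream L hT hw))
    (hwork : ∀ i, workDone (σ.rate (Fin.castAdd L i)) T = ENNReal.ofReal (w i))
    {t D : ℝ} (ht : t ∈ Set.Icc T (T + L))
    (hD : ∑ i, (workDone (σ.rate i) t).toReal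
      ≤ ∑ i, (workDone (σ.rate i) T).toReal + (t - T) + D) :
    ENNReal.ofReal (k - D) ≤ ∑ i, if (burstThenStream L hT hw).release i ≤ t ∧
      ENNReal.ofReal t ≤ σ.completionTime i then 1 else 0 := by
  have hmono : ∀ i, (workDone (σ.rate i) T).toReal ≤ (workDone (σ.rate i) t).toReal := fun i =>
    ENNReal.toReal_mono (σ.workDone_ne_top i t) (workDone_mono _ ht.1)
  have hdone : ∀ i, ¬ ENNReal.ofReal t ≤ σ.completionTime i →
      (burstThenStream L hT hw).size i ≤ (workDone (σ.rate i) t).toReal := fun i hi => by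
    by_contra! hlt
    exact hi (σ.le_completionTime ((ENNReal.lt_ofReal_iff_toReal_lt (σ.workDone_ne_top i t)).2 hlt))
  set ind : Fin (k + L) → ℝ := fun i => if (burstThenStream L hT hw).release i ≤ t ∧
      ENNReal.ofReal t ≤ σ.completionTime i then 1 else 0 with hind
  have hind0 : ∀ i, 0 ≤ ind i := fun i => by simp only [hind]; split_ifs <;> norm_num
  -- The activity indicator dominates the remaining work: at most `1` for an active job, at most `0`
  -- for a completed one. `hnew` is the analogue for stream jobs, counted from their release.
  have hold : ∀ i : Fin k, 1 + (workDone (σ.rate (Fin.castAdd L i)) T).toReal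
      - (workDone (σ.rate (Fin.castAdd L i)) t).toReal ≤ ind (Fin.castAdd L i) := by
    intro i
    by_cases hc : ENNReal.ofReal t ≤ σ.completionTime (Fin.castAdd L i)
    · have : ind (Fin.castAdd L i) = 1 := by
        simp only [hind]
        rw [if_pos ⟨by rw [burstThenStream_release_castAdd]; exact hT.trans ht.1, hc⟩]
      linarith [hmono (Fin.castAdd L i)]
    · have h := hdone _ hc
      rw [burstThenStream_size_castAdd] at h
      rw [hwork i, ENNReal.toReal_ofReal (hw i)]
      linarith [hind0 (Fin.castAdd L i)]
  have hnew : ∀ j : Fin L, (if T + ((j : ℕ) : ℝ) ≤ t then (1 : ℝ) else 0)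
      + (workDone (σ.rate (Fin.natAdd k j)) T).toReal
      - (workDone (σ.rate (Fin.natAdd k j)) t).toReal ≤ ind (Fin.natAdd k j) := by
    intro j
    have hrel := burstThenStream_release_natAdd L hT hw j
    by_cases hr : T + ((j : ℕ) : ℝ) ≤ t
    · rw [if_pos hr]
      by_cases hc : ENNReal.ofReal t ≤ σ.completionTime (Fin.natAdd k j)
      · have : ind (Fin.natAdd k j) = 1 := by
          simp only [hind]
          rw [if_pos ⟨by rw [hrel]; exact hr, hc⟩]
        linarith [hmono (Fin.natAdd k j)]
      · have h := hdone _ hc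
        rw [burstThenStream_size_natAdd] at h
        have h0 : workDone (σ.rate (Fin.natAdd k j)) T = 0 :=
          workDone_eq_zero_of_forall_lt fun s hs => σ.rate_eq_zero_of_lt_release (by
            rw [hrel]
            exact hs.trans_le (by simp))
        rw [h0, ENNReal.toReal_zero]
        linarith [hind0 (Fin.natAdd k j)]
    · rw [if_neg hr]
      linarith [hmono (Fin.natAdd k j), hind0 (Fin.natAdd k j)]
  have hsum : (k : ℝ) - D ≤ ∑ i, ind i := by
    have h1 := Finset.sum_le_sum fun i (_ : i ∈ Finset.univ) => hold i
    have h2 := Finset.sum_le_sum fun j (_ : j ∈ Finset.univ) => hnew j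
    have h3 := le_card_filter_add_le ht.2
    have h4 : ∀ g : Fin (k + L) → ℝ,
        ∑ i, g i = ∑ i : Fin k, g (Fin.castAdd L i) + ∑ j : Fin L, g (Fin.natAdd k j) :=
      fun g => Fin.sum_univ_add g
    have e1 := h4 ind
    have e2 := h4 fun i => (workDone (σ.rate i) T).toReal
    have e3 := h4 fun i => (workDone (σ.rate i) t).toReal
    have hD' := (e3.symm.trans_le hD).trans_eq (congrArg (· + (t - T) + D) e2)
    simp only [Finset.sum_sub_distrib, Finset.sum_add_distrib, Finset.sum_const, Finset.card_univ,
      Fintype.card_fin, nsmul_eq_mul, mul_one] at h1 h2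
    linarith
  refine (ENNReal.ofReal_le_ofReal hsum).trans_eq ?_
  rw [ENNReal.ofReal_sum_of_nonneg fun i _ => hind0 i]
  refine Finset.sum_congr rfl fun i _ => ?_
  simp only [hind]
  split_ifs <;> simp

/-! ### Choice of constants and conclusion -/

theorem inv_mul_rpow_le {α : ℝ} {k : ℝ} (hk : 0 < k) (hα : 2 ≤ α) :
    (α * (1 + 1 / (4 * k)) ^ (α - 1))⁻¹ ≤ 8 * k / α ^ 2 := by
  have hb := one_add_mul_self_le_rpow_one_add (s := 1 / (4 * k)) (p := α - 1)
    (by linarith [show (0 : ℝ) < 1 / (4 * k) by positivity]) (by linarith)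
  have h1 : α / (8 * k) ≤ 1 + (α - 1) * (1 / (4 * k)) := by
    have : α / (8 * k) ≤ (α - 1) * (1 / (4 * k)) := by
      rw [mul_one_div, div_le_div_iff₀ (by positivity) (by positivity)]
      nlinarith
    linarith
  have h2 : α ^ 2 / (8 * k) ≤ α * (1 + 1 / (4 * k)) ^ (α - 1) := by
    calc α ^ 2 / (8 * k) = α * (α / (8 * k)) := by ring
      _ ≤ _ := mul_le_mul_of_nonneg_left (h1.trans hb) (by linarith)
  calc _ ≤ (α ^ 2 / (8 * k))⁻¹ := inv_anti₀ (by positivity) h2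
    _ = _ := by rw [inv_div]

theorem NonclairvoyantAlgorithm.IsCompetitive.le_mul {A : NonclairvoyantAlgorithm} {α C : ℝ}
    (hA : A.IsCompetitive α C) {k : ℕ} (hk : 1 ≤ k) (hkα : 10 * (k : ℝ) ^ 3 ≤ α) :
    (k : ℝ) ≤ 30 * C := by
  by_contra! hCk
  have hk1 : (1 : ℝ) ≤ k := by exact_mod_cast hk
  have hk3 : (1 : ℝ) ≤ (k : ℝ) ^ 3 := one_le_pow₀ hk1
  have hα10 : 10 ≤ α := by linarith
  have hα1 : 1 ≤ α := by linarith
  have hC1 : 1 ≤ C := hA.one_le hα1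
  have hC0 : 0 ≤ C := by linarith
  set T : ℝ := 2 * (k : ℝ) ^ 2 with hTdef
  have hT : 0 < T := by positivity
  -- Size `2 * T = 4 * k ^ 2` exceeds the total work bound `hW`, so no job completes by `T`.
  set I := burst k (2 * T) (by positivity) with hI
  -- The work done by time `T` on the burst.
  have hwork0 : ∀ i : Fin I.n, (workDone ((A.run I).rate i) 0).toReal = 0 := fun i => by
    rw [workDone_eq_zero_of_forall_lt fun s hs =>
      (A.run I).rate_eq_zero_of_lt_release (hs.trans_le (I.release_nonneg i)), ENNReal.toReal_zero]
  set w : Fin k → ℝ := fun i => (workDone ((A.run I).rate i) T).toReal with hwdef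
  have hw : ∀ i, 0 ≤ w i := fun i => ENNReal.toReal_nonneg
  -- With `lam = 1 + 1 / (4 * k)` the excess over unit speed costs `k / 2` over `[0, T]`, and the
  -- energy term contributes at most another `k / 2`.
  have hW : ∑ i, w i ≤ 2 * (k : ℝ) ^ 2 + k := by
    have h := hA.sum_toReal_workDone_le hα1 hC0 (by positivity)
      (optCost_burst_le hα1 k (M := 2 * T) (by positivity))
      (lam := 1 + 1 / (4 * k)) (by positivity) le_rfl hT.le
    have h0 : ∑ i : Fin I.n, (workDone ((A.run I).rate i) 0).toReal = 0 :=
      Finset.sum_eq_zero fun i _ => hwork0 i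
    have hκ := inv_mul_rpow_le (α := α) (k := (k : ℝ)) (by linarith) (by linarith)
    have hcost : C * (k * (k + 1) * (2 * T)) ≤ (4 / 15) * (k : ℝ) ^ 5 := by
      have h1 : (k : ℝ) * (k + 1) * (2 * T) ≤ 8 * (k : ℝ) ^ 4 := by
        rw [hTdef]; nlinarith [pow_pos (zero_lt_one.trans_le hk1) 3]
      have h2 : C * (k * (k + 1) * (2 * T)) ≤ (k / 30) * (8 * (k : ℝ) ^ 4) :=
        mul_le_mul (by linarith) h1 (by positivity) (by positivity)
      linarith
    have hprod : (α * (1 + 1 / (4 * (k : ℝ))) ^ (α - 1))⁻¹ * (C * (k * (k + 1) * (2 * T)))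
        ≤ k / 2 := by
      calc _ ≤ (8 * k / α ^ 2) * ((4 / 15) * (k : ℝ) ^ 5) :=
            mul_le_mul hκ hcost (by positivity) (by positivity)
        _ ≤ 1 / 2 := by
            rw [div_mul_eq_mul_div, div_le_iff₀ (by positivity)]
            have : (10 * (k : ℝ) ^ 3) ^ 2 ≤ α ^ 2 := by gcongr
            nlinarith
        _ ≤ k / 2 := by linarith
    have hlam : (1 + 1 / (4 * (k : ℝ))) * (T - 0) = 2 * (k : ℝ) ^ 2 + k / 2 := by
      rw [hTdef]; field_simp; ring
    have h' := h.trans (add_le_add_right hprod _)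
    rw [hlam] at h'
    calc ∑ i, w i ≤ _ := h'
      _ ≤ _ := by
        rw [h0]
        linarith
  have hwT : ∀ i, w i < 2 * T := fun i => by
    have := (Finset.single_le_sum (fun i _ => hw i) (Finset.mem_univ i)).trans hW
    rw [hTdef]; nlinarith
  have hwof : ∀ i : Fin k, workDone ((A.run I).rate i) T = ENNReal.ofReal (w i) := fun i =>
    (ENNReal.ofReal_toReal ((A.run I).workDone_ne_top i T)).symm
  -- The burst followed by a stream, and its optimal cost.
  obtain ⟨m, -, hmax⟩ := Finset.exists_max_image Finset.univ w
    ⟨(⟨0, hk⟩ : Fin k), Finset.mem_univ _⟩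
  have hWm : ∑ i, w i ≤ k * w m := by
    have := Finset.sum_le_card_nsmul Finset.univ w (w m) hmax
    simpa using this
  -- Removing the largest `w` removes at least the average, leaving at most `(k - 1) * (2 * k + 1)`.
  -- The extra `k - 1` units then still fit below `2 * k ^ 2`.
  have hmT : ∑ i, (w i + 1) - (w m + 1) ≤ T := by
    rw [Finset.sum_add_distrib]
    simp only [Finset.sum_const, Finset.card_univ, Fintype.card_fin, nsmul_eq_mul, mul_one]
    rw [hTdef]
    have h1 : (k : ℝ) * (∑ i, w i - w m) ≤ (k - 1) * (2 * (k : ℝ) ^ 2 + k) := by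
      nlinarith
    have h2 : ∑ i, w i - w m ≤ (k - 1) * (2 * k + 1) := by
      refine le_of_mul_le_mul_left ?_ (by linarith : (0 : ℝ) < k)
      linarith
    linarith
  -- The stream length matches the order of the burst's cost `k * T`, so the optimum stays of order
  -- `k ^ 3`.
  set L : ℕ := k ^ 3 with hL
  set J := burstThenStream L hT.le hw with hJ
  have hopt : optCost α J ≤ ENNReal.ofReal (15 * (k : ℝ) ^ 3) := by
    refine (optCost_burstThenStream_le hα1 L hT.le hw m hmT).trans (ENNReal.ofReal_le_ofReal ?_)
    rw [hTdef, hL]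
    push_cast
    nlinarith [mul_nonneg (mul_nonneg (by positivity : (0 : ℝ) ≤ k) (sub_nonneg.2 hk1))
      (by positivity : (0 : ℝ) ≤ (k : ℝ) + 1)]
  have hagree : ∀ i : Fin k,
      workDone ((A.run J).rate (Fin.castAdd L i)) T = ENNReal.ofReal (w i) := by
    intro i
    rw [← hwof]
    refine A.workDone_eq_of_extends (I := I) (J := J) (T := T) (Fin.castAdd L) (fun _ => rfl)
      (fun i => burstThenStream_release_castAdd L hT.le hw i) ?_ ?_ ?_ i
    · refine Fin.addCases (fun i hi => ?_) (fun j _ => ?_)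
      · exact absurd ⟨i, rfl⟩ hi
      · rw [burstThenStream_release_natAdd]
        simp
    · intro i
      rw [hwof i]
      exact (ENNReal.ofReal_lt_ofReal_iff (I.size_pos i)).2 (hwT i)
    · intro i
      change Fin k at i
      have hsize : J.size (Fin.castAdd L i) = w i + 1 := burstThenStream_size_castAdd L hT.le hw i
      rw [hwof i]
      refine lt_of_lt_of_eq ?_ (congrArg ENNReal.ofReal hsize.symm)
      exact (ENNReal.ofReal_lt_ofReal_iff (by linarith [hw i])).2 (by linarith)
  -- The flow time accumulated during the stream.
  have hCB : C * (15 * (k : ℝ) ^ 3) < (k : ℝ) ^ 4 / 2 := by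
    have := mul_lt_mul_of_pos_right hCk (zero_lt_one.trans_le hk3)
    nlinarith
  have hactive : ∀ t ∈ Set.Icc T (T + L), ENNReal.ofReal (k / 2) ≤
      ∑ i, if J.release i ≤ t ∧ ENNReal.ofReal t ≤ (A.run J).completionTime i then 1 else 0 := by
    intro t ht
    -- Here `lam = 1`, the arrival rate; the lead over the stream is at most `15 * C * k ^ 3 / α`,
    -- below `k / 2`.
    have h := hA.sum_toReal_workDone_le hα1 hC0 (by positivity) hopt one_pos hT.le ht.1
    rw [Real.one_rpow, mul_one, one_mul] at h
    refine (ENNReal.ofReal_le_ofReal ?_).trans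
      (le_card_active_burstThenStream hT.le hw (A.run J) hagree ht h)
    have : α⁻¹ * (C * (15 * (k : ℝ) ^ 3)) ≤ k / 2 := by
      rw [inv_mul_le_iff₀ (by linarith)]
      nlinarith
    linarith
  have hflow := (A.run J).mul_le_totalFlowTime hactive
  have hfinal := hflow.trans (le_self_add.trans (hA.cost_le hC0 hopt))
  rw [add_sub_cancel_left, ← ENNReal.ofReal_mul (by positivity),
    ENNReal.ofReal_le_ofReal_iff (by positivity), hL] at hfinal
  push_cast at hfinal
  nlinarith

end SpeedScaling

end

theorem theorem2 (ε : ℝ) (hε : 0 < ε) (hε' : ε < 1 / 3) :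
    ∃ c : ℝ, 0 < c ∧ ∀ α : ℝ, 1 < α →
      ∀ (A : SpeedScaling.NonclairvoyantAlgorithm) (C : ℝ),
        A.IsCompetitive α C → c * α ^ (1 / 3 - ε) ≤ C := by
  refine ⟨1 / 180, by norm_num, fun α hα A C hA => ?_⟩
  have hC1 : 1 ≤ C := hA.one_le hα.le
  set x : ℝ := α ^ (1 / 3 : ℝ) with hx
  have hx0 : 0 ≤ x := Real.rpow_nonneg (by linarith) _
  have hx3 : x ^ 3 = α := by
    rw [hx, ← Real.rpow_natCast, ← Real.rpow_mul (by linarith)]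
    norm_num
  have hle : α ^ (1 / 3 - ε) ≤ x := Real.rpow_le_rpow_of_exponent_le hα.le (by linarith)
  suffices h : x ≤ 180 * C by linarith
  by_cases hsmall : x < 3
  · linarith
  have hy : 1 ≤ x / 3 := by linarith
  -- With `k = ⌊x / 3⌋₊`, `10 * k ^ 3 ≤ 10 * α / 27 ≤ α`, and `x < 3 * (k + 1) ≤ 6 * k ≤ 180 * C`.
  have hk : 1 ≤ ⌊x / 3⌋₊ := Nat.le_floor (by exact_mod_cast hy)
  have hfl : (⌊x / 3⌋₊ : ℝ) ≤ x / 3 := Nat.floor_le (by positivity)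
  have hlt := Nat.lt_floor_add_one (x / 3)
  have hk1 : (1 : ℝ) ≤ ⌊x / 3⌋₊ := by exact_mod_cast hk
  have := hA.le_mul hk (by
    have : (⌊x / 3⌋₊ : ℝ) ^ 3 ≤ (x / 3) ^ 3 := by gcongr
    have h27 : (x / 3) ^ 3 = α / 27 := by rw [div_pow, hx3]; norm_num
    linarith)
  linarith
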